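/- For integers $m, k \ge 1$ let $K_{m*k}$ denote the complete $k$-partite graph with $k$ color classes, each of size $m$. The choice number $ch(G)$ of a finite graph $G$ is the smallest integer $s$ such that for every assignment of a list of $s$ colors to each vertex of $G$ there is a proper coloring of $G$ assigning to each vertex a color from its list. Theorem. For every fixed integer $m \ge 1$ the limit $$c(m) = \lim_{k \to \infty} \frac{ch(K_{m*k})}{k}$$ exists (as a finite real number). Moreover $c(m) = \Theta(\ln m)$, that is, there are absolute constants $a, b > 0$ such that $a \ln m \le c(m) \le b \ln m$ for every integer $m \ge 2$. -/

import Mathlib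

open Filter Topology

universe u

/-- `G` is `s`-choosable: for every assignment of a list (finite set) of exactly `s` colors to each
vertex of `G`, there is a proper coloring of `G` giving every vertex a color from its own list. -/
def IsChoosable {V : Type u} (G : SimpleGraph V) (s : ℕ) : Prop :=
  ∀ (α : Type u) (L : V → Finset α), (∀ v, (L v).card = s) →
    ∃ C : G.Coloring α, ∀ v, C v ∈ L v

/-- The choice number of `G`: the smallest `s` such that `G` is `s`-choosable.
For a graph with finitely many vertices such an `s` exists, see `isChoosable_choiceNumber`. -/
noncomputable def choiceNumber {V : Type u} (G : SimpleGraph V) : ℕ :=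
  sInf {s : ℕ | IsChoosable G s}

/-- A graph on `n` vertices is `n`-choosable (the colors can even be chosen all distinct). -/
theorem isChoosable_card {V : Type u} [Fintype V] (G : SimpleGraph V) :
    IsChoosable G (Fintype.card V) := by
  classical
  intro α L hL
  obtain ⟨f, hf, hfL⟩ := (Finset.all_card_le_biUnion_card_iff_exists_injective L).1 (by
    intro A
    rcases A.eq_empty_or_nonempty with rfl | ⟨v, hv⟩
    · simp
    · calc A.card ≤ Fintype.card V := A.card_le_univ
        _ = (L v).card := (hL v).symm
        _ ≤ (A.biUnion L).card := Finset.card_le_card (Finset.subset_biUnion_of_mem L hv))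
  exact ⟨SimpleGraph.Coloring.mk f (fun h => hf.ne h.ne), hfL⟩

/-- The minimum in the definition of the choice number of a finite graph is attained. -/
theorem isChoosable_choiceNumber {V : Type u} [Fintype V] (G : SimpleGraph V) :
    IsChoosable G (choiceNumber G) :=
  Nat.sInf_mem (s := {s : ℕ | IsChoosable G s}) ⟨_, isChoosable_card G⟩

/-- `K_{m*k}`: the complete `k`-partite graph with `k` color classes, each of size `m`.
The vertex `(i, j)` is the `j`-th vertex of the `i`-th class, and two vertices are adjacent if and
only if they lie in different classes. -/
abbrev multipartiteK (m k : ℕ) : SimpleGraph (Fin k × Fin m) :=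
  SimpleGraph.completeEquipartiteGraph k m

/-!
Write `ch k` for the choice number of `K_{m*k}`.

*Splitting.* Assign every color to one of `q` blocks at random, each block consisting of `k` of the
`q * k` classes. A list of `S` colors keeps about `S / q` colors of the block of its vertex, and by
Chernoff's bound all lists simultaneously keep almost that many, provided `log (q * k * m)` is small
compared with `k`. The blocks then use disjoint sets of colors and can be colored independently, so
`ch (q * k) / (q * k)` is at most slightly larger than `ch k / k` (`IsChoosable.multipartiteK_mul`,
`choiceNumber_multipartiteK_mul_le`). Doubling repeatedly, the relative errors decay geometrically,
so they stay bounded by a small total; together with one splitting into `q` blocks and monotonicity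
in `k` this reaches every large number of classes (`choiceNumber_multipartiteK_div_le`). A bounded
sequence whose late terms are at most slightly larger than its earlier ones converges.

*Upper bound.* Splitting from a single class, where one color per list is enough, gives
`ch k / k = O(log (k * m))`. For `k = 36 * m` this is `O(log m)`, and `36 * m` is already large
enough for the iterated splitting to lose only a constant factor from there on.

*Lower bound.* Let `4 ^ t ≤ m`. The `(t + 1)`-subsets of a `(2 * t + 1)`-set number at most `m`, and
no `t` points meet all of them. Blowing up the points gives lists on which every class needs colors
over at least `t + 1` points, which is impossible for many classes at once
(`not_isChoosable_multipartiteK`).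
-/

/-! ### Monotonicity of choosability -/

theorem IsChoosable.mono {V : Type u} {G : SimpleGraph V} {s t : ℕ} (h : IsChoosable G s)
    (hst : s ≤ t) : IsChoosable G t := by
  intro α L hL
  choose L' hL' hcard using fun v => Finset.exists_subset_card_eq (hst.trans (hL v).ge)
  obtain ⟨C, hC⟩ := h α L' hcard
  exact ⟨C, fun v => hL' v (hC v)⟩

theorem choiceNumber_le_iff {V : Type u} [Fintype V] {G : SimpleGraph V} {s : ℕ} :
    choiceNumber G ≤ s ↔ IsChoosable G s :=
  ⟨fun h => (isChoosable_choiceNumber G).mono h, fun h => Nat.sInf_le h⟩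

theorem IsChoosable.multipartiteK_mono {m k l s : ℕ} (hk : 1 ≤ k) (hkl : k ≤ l)
    (h : IsChoosable (multipartiteK m l) s) : IsChoosable (multipartiteK m k) s := by
  intro α L hL
  -- the additional classes receive copies of the lists of the last of the `k` classes
  let r : Fin l → Fin k := fun x => ⟨min x (k - 1), by omega⟩
  have hr : ∀ i : Fin k, r (Fin.castLE hkl i) = i := by
    intro i
    ext
    simp only [r, Fin.val_castLE]
    omega
  obtain ⟨C, hC⟩ := h α (fun v => L (r v.1, v.2)) (fun v => hL _)
  refine ⟨SimpleGraph.Coloring.mk (fun v => C (Fin.castLE hkl v.1, v.2)) ?_, fun v => ?_⟩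
  · intro v w hvw
    refine C.valid ?_
    simpa using hvw
  · have := hC (Fin.castLE hkl v.1, v.2)
    rw [hr] at this
    exact this

/-- A single class carries no edges. -/
theorem isChoosable_multipartiteK_one (m : ℕ) : IsChoosable (multipartiteK m 1) 1 := by
  intro α L hL
  have hne : ∀ v, (L v).Nonempty := fun v => Finset.card_pos.1 (by simp [hL v])
  choose f hf using hne
  exact ⟨SimpleGraph.Coloring.mk f fun {v w} hvw => absurd (Subsingleton.elim v.1 w.1) hvw, hf⟩

/-! ### The lower bound -/

/-- Give each class the same `m` lists, running over the blow-ups of all `(t + 1)`-subsets of a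
`(2t + 1)`-set, every point being blown up to `B` colors. The colors used on one class meet all
these lists, hence lie over at least `t + 1` points, and distinct classes use distinct colors. -/
theorem not_isChoosable_multipartiteK {m k t B : ℕ} (ht : 4 ^ t ≤ m)
    (hB : (2 * t + 1) * B < k * (t + 1)) :
    ¬ IsChoosable (multipartiteK m k) ((t + 1) * B) := by
  classical
  intro h
  obtain ⟨e, he⟩ : ∃ e : Fin m → Finset (Fin (2 * t + 1)), (∀ j, (e j).card = t + 1) ∧
      ∀ E : Finset (Fin (2 * t + 1)), E.card = t + 1 → ∃ j, e j = E := by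
    let X := {E : Finset (Fin (2 * t + 1)) // E.card = t + 1}
    have hcard : Fintype.card X ≤ m := by
      have : Fintype.card X = (2 * t + 1).choose (t + 1) := by
        simp [X]
      rw [this, Nat.choose_symm_half]
      exact (Nat.choose_middle_le_pow t).trans ht
    have hX : Nonempty X := by
      obtain ⟨E, -, hE⟩ := Finset.exists_subset_card_eq
        (s := (Finset.univ : Finset (Fin (2 * t + 1)))) (n := t + 1) (by simp; omega)
      exact ⟨⟨E, hE⟩⟩
    obtain ⟨g⟩ : Nonempty (X ↪ Fin m) :=
      Function.Embedding.nonempty_of_card_le (by simpa using hcard)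
    refine ⟨fun j => (Function.invFun g j).1, fun j => (Function.invFun g j).2, fun E hE => ?_⟩
    exact ⟨g ⟨E, hE⟩, congrArg Subtype.val (Function.leftInverse_invFun g.injective ⟨E, hE⟩)⟩
  obtain ⟨C, hC⟩ := h (Fin (2 * t + 1) × Fin B) (fun v => e v.2 ×ˢ Finset.univ)
    (fun v => by simp [he.1])
  let T : Fin k → Finset (Fin (2 * t + 1) × Fin B) :=
    fun i => Finset.univ.image fun j => C (i, j)
  have hT : ∀ i, t + 1 ≤ (T i).card := by
    intro i
    by_contra hlt
    have h1 : ((T i).image Prod.fst).card ≤ t := Finset.card_image_le.trans (by omega)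
    have h2 : t + 1 ≤ ((T i).image Prod.fst)ᶜ.card := by
      rw [Finset.card_compl, Fintype.card_fin]
      omega
    obtain ⟨E, hE, hEc⟩ := Finset.exists_subset_card_eq h2
    obtain ⟨j, rfl⟩ := he.2 E hEc
    have h3 := hC (i, j)
    simp only [Finset.mem_product, Finset.mem_univ, and_true] at h3
    have h4 := hE h3
    rw [Finset.mem_compl] at h4
    exact h4 (Finset.mem_image_of_mem _ (Finset.mem_image_of_mem _ (Finset.mem_univ _)))
  have hdisj : ((Finset.univ : Finset (Fin k)) : Set (Fin k)).PairwiseDisjoint T := by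
    intro i _ i' _ hii'
    simp only [Function.onFun, Finset.disjoint_left, T, Finset.mem_image, Finset.mem_univ,
      true_and]
    rintro _ ⟨j, rfl⟩ ⟨j', hj'⟩
    exact C.valid (v := (i', j')) (w := (i, j)) hii'.symm hj'
  have h5 : (Finset.univ.biUnion T).card ≤ (2 * t + 1) * B := by
    simpa using Finset.card_le_univ (Finset.univ.biUnion T)
  rw [Finset.card_biUnion hdisj] at h5
  have h6 : k * (t + 1) ≤ ∑ i, (T i).card := by
    simpa using Finset.sum_le_sum fun i (_ : i ∈ Finset.univ) => hT i
  omega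

/-! ### Random splitting of the colors -/

/-- The exponential moment of the number of elements of `A` that a uniformly random
`f : U → Fin q` sends to `a`. -/
theorem sum_pow_card_filter_eq {U : Type*} [Fintype U] [DecidableEq U] {q : ℕ} (A : Finset U)
    (a : Fin q) (x : ℝ) :
    ∑ f : U → Fin q, x ^ (A.filter fun u => f u = a).card =
      (q - 1 + x) ^ A.card * (q : ℝ) ^ (Fintype.card U - A.card) := by
  have h1 : ∀ f : U → Fin q, x ^ (A.filter fun u => f u = a).card =
      ∏ u, (if u ∈ A then (if f u = a then x else 1) else 1) := by
    intro f
    rw [Finset.prod_ite_mem, Finset.univ_inter, Finset.prod_ite, Finset.prod_const,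
      Finset.prod_const_one, mul_one]
  simp_rw [h1]
  rw [← Fintype.prod_sum (fun u (b : Fin q) => if u ∈ A then (if b = a then x else 1) else 1)]
  have h2 : ∀ u, (∑ b : Fin q, if u ∈ A then (if b = a then x else 1) else 1) =
      if u ∈ A then (q : ℝ) - 1 + x else q := by
    intro u
    split_ifs
    · rw [← Finset.add_sum_erase _ _ (Finset.mem_univ a), if_pos rfl,
        Finset.sum_congr rfl fun b hb => if_neg (Finset.ne_of_mem_erase hb)]
      have : 1 ≤ q := a.pos
      simp [Nat.cast_sub this]
      ring
    · simp
  simp_rw [h2]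
  rw [Finset.prod_ite, Finset.prod_const, Finset.prod_const, Finset.filter_mem_eq_inter,
    Finset.univ_inter]
  congr 2
  rw [← Finset.card_compl]
  congr 1
  ext
  simp

/-- Chernoff's lower tail bound combined with a union bound: the colors can be distributed over
`q` parts so that each list `L v` keeps at least `s` colors in its designated part `p v`. -/
theorem exists_forall_le_card_filter {ι α : Type*} [Fintype ι] {q S s : ℕ} (hq : 1 ≤ q)
    (L : ι → Finset α) (p : ι → Fin q) (hL : ∀ v, (L v).card = S) {r : ℝ} (hr : 0 ≤ r)
    (h : Fintype.card ι * Real.exp (r * s - S / q * (r / (1 + r))) < 1) :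
    ∃ f : α → Fin q, ∀ v, s ≤ ((L v).filter fun u => f u = p v).card := by
  classical
  let U := Finset.univ.biUnion L
  let A : ι → Finset U := fun v => (L v).subtype (· ∈ U)
  have hAL : ∀ v, (A v).map (Function.Embedding.subtype _) = L v := by
    intro v
    exact Finset.subtype_map_of_mem fun x hx => Finset.mem_biUnion.2 ⟨v, Finset.mem_univ v, hx⟩
  have hA : ∀ v, (A v).card = S := by
    intro v
    rw [← hL v, ← hAL v, Finset.card_map]
  have hq0 : (0 : ℝ) < q := by exact_mod_cast hq
  -- it suffices to treat functions on the finite set of colors that occur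
  suffices H : ∃ f : U → Fin q, ∀ v, s ≤ ((A v).filter fun u => f u = p v).card by
    obtain ⟨f, hf⟩ := H
    refine ⟨fun u => if hu : u ∈ U then f ⟨u, hu⟩ else ⟨0, hq⟩, fun v => (hf v).trans ?_⟩
    rw [← hAL v, Finset.filter_map, Finset.card_map]
    refine Finset.card_le_card fun u hu => ?_
    have hu' := Finset.mem_filter.1 hu
    exact Finset.mem_filter.2 ⟨hu'.1, (dif_pos u.2).trans hu'.2⟩
  by_contra! hbad
  have h1 : ∀ f : U → Fin q, (1 : ℝ) ≤ ∑ v, Real.exp (r * s) *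
      Real.exp (-r) ^ ((A v).filter fun u => f u = p v).card := by
    intro f
    obtain ⟨v, hv⟩ := hbad f
    refine le_trans ?_ (Finset.single_le_sum (f := fun v => Real.exp (r * s) *
      Real.exp (-r) ^ ((A v).filter fun u => f u = p v).card) (fun v _ => by positivity)
      (Finset.mem_univ v))
    rw [← Real.exp_nat_mul, ← Real.exp_add, Real.one_le_exp_iff]
    have : (((A v).filter fun u => f u = p v).card : ℝ) ≤ s := by exact_mod_cast hv.le
    nlinarith
  have h2 : (q : ℝ) ^ Fintype.card U ≤ ∑ _v : ι, Real.exp (r * s) *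
      ((q - 1 + Real.exp (-r)) ^ S * (q : ℝ) ^ (Fintype.card U - S)) := by
    calc (q : ℝ) ^ Fintype.card U = ∑ _f : U → Fin q, (1 : ℝ) := by simp
      _ ≤ ∑ f : U → Fin q, ∑ v, Real.exp (r * s) *
          Real.exp (-r) ^ ((A v).filter fun u => f u = p v).card :=
        Finset.sum_le_sum fun f _ => h1 f
      _ = ∑ v, ∑ f : U → Fin q, Real.exp (r * s) *
          Real.exp (-r) ^ ((A v).filter fun u => f u = p v).card := Finset.sum_comm
      _ = _ := Finset.sum_congr rfl fun v _ => by
        rw [← Finset.mul_sum, sum_pow_card_filter_eq, hA]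
  rcases isEmpty_or_nonempty ι with hι | ⟨⟨v₀⟩⟩
  · simp at h2
    have : 0 < (q : ℝ) ^ Fintype.card U := by positivity
    simp at this
    linarith
  have hSU : S ≤ Fintype.card U := hA v₀ ▸ Finset.card_le_univ _
  have h3 : (q : ℝ) - 1 + Real.exp (-r) ≤ q * Real.exp (-(r / (1 + r) / q)) := by
    have h4 : Real.exp (-r) ≤ 1 / (1 + r) := by
      rw [Real.exp_neg, ← one_div]
      exact one_div_le_one_div_of_le (by positivity) (by linarith [Real.add_one_le_exp r])
    have h5 := Real.add_one_le_exp (-(r / (1 + r) / q))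
    have h6 : (q : ℝ) * (-(r / (1 + r) / q) + 1) ≤ q * Real.exp (-(r / (1 + r) / q)) := by gcongr
    have h7 : (q : ℝ) * (-(r / (1 + r) / q) + 1) = q - 1 + 1 / (1 + r) := by
      field_simp
      ring
    linarith
  have h0 : (0 : ℝ) ≤ q - 1 + Real.exp (-r) := by
    have : (1 : ℝ) ≤ q := by exact_mod_cast hq
    linarith [Real.exp_pos (-r)]
  have h8 : ((q : ℝ) - 1 + Real.exp (-r)) ^ S * (q : ℝ) ^ (Fintype.card U - S) ≤
      q ^ Fintype.card U * Real.exp (-(S / q * (r / (1 + r)))) := by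
    calc ((q : ℝ) - 1 + Real.exp (-r)) ^ S * (q : ℝ) ^ (Fintype.card U - S)
        ≤ (q * Real.exp (-(r / (1 + r) / q))) ^ S * (q : ℝ) ^ (Fintype.card U - S) := by gcongr
      _ = q ^ (S + (Fintype.card U - S)) * Real.exp (-(r / (1 + r) / q)) ^ S := by
        rw [mul_pow, pow_add]; ring
      _ = _ := by
        rw [Nat.add_sub_cancel' hSU, ← Real.exp_nat_mul]
        congr 2
        ring
  have h9 : (q : ℝ) ^ Fintype.card U ≤ q ^ Fintype.card U *
      (Fintype.card ι * Real.exp (r * s - S / q * (r / (1 + r)))) := by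
    refine h2.trans ?_
    rw [Finset.sum_const, nsmul_eq_mul, Finset.card_univ, sub_eq_add_neg (r * (s : ℝ)), Real.exp_add]
    calc _ ≤ (Fintype.card ι : ℝ) * (Real.exp (r * s) *
          (q ^ Fintype.card U * Real.exp (-(S / q * (r / (1 + r)))))) := by gcongr
      _ = _ := by ring
  have h10 : 0 < (q : ℝ) ^ Fintype.card U := by positivity
  nlinarith

/-- Splitting lemma: the `q * k` classes are cut into `q` blocks of `k` classes, and each color is
given to a random block. If every list keeps `s` colors of its own block, then the blocks can be
colored independently of each other. -/
theorem IsChoosable.multipartiteK_mul {m k q s S : ℕ} (h : IsChoosable (multipartiteK m k) s)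
    (hm : 1 ≤ m) (hk : 1 ≤ k) (hq : 1 ≤ q) {r : ℝ} (hr : 0 ≤ r)
    (hS : Real.log (q * k * m) + r * s < S / q * (r / (1 + r))) :
    IsChoosable (multipartiteK m (q * k)) S := by
  classical
  intro α L hL
  let e : Fin q × Fin k ≃ Fin (q * k) := finProdFinEquiv
  have hm0 : (0 : ℝ) < m := by exact_mod_cast hm
  have hk0 : (0 : ℝ) < k := by exact_mod_cast hk
  have hq0 : (0 : ℝ) < q := by exact_mod_cast hq
  obtain ⟨f, hf⟩ := exists_forall_le_card_filter (s := s) hq L (fun v => (e.symm v.1).1) hL hr (by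
    have : ((Fintype.card (Fin (q * k) × Fin m) : ℕ) : ℝ) = Real.exp (Real.log (q * k * m)) := by
      rw [Real.exp_log (by positivity)]
      simp
    rw [this, ← Real.exp_add, Real.exp_lt_one_iff]
    linarith)
  choose M hM hMcard using fun v => Finset.exists_subset_card_eq (hf v)
  choose C hC using fun a : Fin q =>
    h α (fun w => M (e (a, w.1), w.2)) (fun w => hMcard _)
  have hC' : ∀ v : Fin (q * k) × Fin m,
      C (e.symm v.1).1 ((e.symm v.1).2, v.2) ∈ M v := by
    intro v
    simpa using hC (e.symm v.1).1 ((e.symm v.1).2, v.2)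
  refine ⟨SimpleGraph.Coloring.mk (fun v => C (e.symm v.1).1 ((e.symm v.1).2, v.2)) ?_,
    fun v => (Finset.mem_filter.1 (hM v (hC' v))).1⟩
  intro v w hvw heq
  have hv := (Finset.mem_filter.1 (hM v (hC' v))).2
  have hw := (Finset.mem_filter.1 (hM w (hC' w))).2
  have hblock : (e.symm v.1).1 = (e.symm w.1).1 := by
    rw [← hv, ← hw, heq]
  rw [hblock] at heq
  refine (C (e.symm w.1).1).valid (v := ((e.symm v.1).2, v.2)) (w := ((e.symm w.1).2, w.2)) ?_ heq
  intro hne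
  exact hvw (e.symm.injective (Prod.ext hblock hne))

theorem le_choiceNumber_multipartiteK {m k : ℕ} (hm : 1 ≤ m) (hk : 1 ≤ k) :
    k ≤ choiceNumber (multipartiteK m k) := by
  have h := not_isChoosable_multipartiteK (m := m) (k := k) (t := 0) (B := k - 1) (by simpa)
    (by omega)
  rw [← choiceNumber_le_iff] at h
  omega

/-! ### Iterated splitting -/

/-- Splitting into `q` blocks costs a factor `1 + 2 * ε` in `choiceNumber (multipartiteK m k) / k`
as long as `q * k * m` is at most exponential in `ε ^ 2 * k`. -/
theorem choiceNumber_multipartiteK_mul_le {m k q : ℕ} (hm : 1 ≤ m) (hk : 1 ≤ k) (hq : 1 ≤ q)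
    {ε : ℝ} (hε : 0 < ε) (hε1 : ε ≤ 1) (hεk : 1 ≤ ε ^ 2 * k)
    (hlog : Real.log (q * k * m) < ε ^ 2 * k / 6) :
    (choiceNumber (multipartiteK m (q * k)) : ℝ) ≤
      q * (1 + 2 * ε) * choiceNumber (multipartiteK m k) := by
  set s := choiceNumber (multipartiteK m k) with hs
  have hsk : (k : ℝ) ≤ s := by exact_mod_cast le_choiceNumber_multipartiteK hm hk
  have hq1 : (1 : ℝ) ≤ q := by exact_mod_cast hq
  have hk0 : (0 : ℝ) < k := by exact_mod_cast hk
  have hqs : 0 ≤ (q : ℝ) * (1 + ε) * s := by positivity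
  have hS := Nat.le_ceil ((q : ℝ) * (1 + ε) * s)
  have hS' := Nat.ceil_lt_add_one hqs
  set S := ⌈(q : ℝ) * (1 + ε) * s⌉₊
  have hmain : IsChoosable (multipartiteK m (q * k)) S := by
    refine (isChoosable_choiceNumber (multipartiteK m k)).multipartiteK_mul hm hk hq
      -- `r = ε / 2` approximately maximizes the gain `((1 + ε) / (1 + r) - 1) * r * s`
      (r := ε / 2) (by positivity) ?_
    rw [← hs]
    have h1 : (1 + ε) * s ≤ S / q := by
      rw [le_div_iff₀ (by positivity)]
      linarith
    have h2 : (1 + ε) * s * (ε / 2 / (1 + ε / 2)) ≤ S / q * (ε / 2 / (1 + ε / 2)) := by gcongr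
    have h3 : (1 + ε) * s * (ε / 2 / (1 + ε / 2)) = ε / 2 * s + ε ^ 2 * s / (4 + 2 * ε) := by
      field_simp
      ring
    have h4 : ε ^ 2 * k / 6 ≤ ε ^ 2 * s / (4 + 2 * ε) := by
      gcongr
      linarith
    linarith
  have h5 : (choiceNumber (multipartiteK m (q * k)) : ℝ) ≤ S := by
    exact_mod_cast choiceNumber_le_iff.2 hmain
  have h6 : 1 ≤ q * ε * s := by
    calc 1 ≤ ε ^ 2 * k := hεk
      _ = 1 * (ε * ε) * k := by ring
      _ ≤ q * (1 * ε) * s := by gcongr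
      _ = _ := by ring
  linarith

/-- Repeated doubling costs only a bounded factor, uniformly in the number `i` of doublings. -/
theorem choiceNumber_multipartiteK_two_pow_mul_le {m : ℕ} (hm : 1 ≤ m) (i : ℕ) :
    ∀ {k : ℕ} {ε : ℝ}, 1 ≤ k → 0 < ε → ε ≤ 1 → 36 ≤ ε ^ 2 * k →
      Real.log (2 * k * m) < ε ^ 2 * k / 6 →
      (choiceNumber (multipartiteK m (2 ^ i * k)) : ℝ) ≤
        2 ^ i * Real.exp (8 * ε) * choiceNumber (multipartiteK m k) := by
  induction i with
  | zero =>
    intro k ε _ hε _ _ _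
    have : 1 ≤ Real.exp (8 * ε) := Real.one_le_exp (by positivity)
    rw [pow_zero, one_mul, pow_zero, one_mul]
    exact le_mul_of_one_le_left (Nat.cast_nonneg _) this
  | succ i ih =>
    intro k ε hk hε hε1 hεk hlog
    have hm0 : (0 : ℝ) < m := by exact_mod_cast hm
    have hk0 : (0 : ℝ) < k := by exact_mod_cast hk
    have h1 := choiceNumber_multipartiteK_mul_le (q := 2) hm hk (by norm_num) hε hε1 (by linarith)
      (by exact_mod_cast hlog)
    -- with `ε` replaced by `3 * ε / 4`, the quantity `ε ^ 2 * k` grows by the factor `9 / 8`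
    -- under doubling `k`, and the sum of the errors is a geometric series
    have h2 := ih (k := 2 * k) (ε := 3 * ε / 4) (by omega) (by positivity) (by linarith)
      (by push_cast; nlinarith) (by
        have : (2 * ((2 * k : ℕ) : ℝ) * m) = 2 * (2 * k * m) := by push_cast; ring
        rw [this, Real.log_mul (by norm_num) (by positivity)]
        have := Real.log_two_lt_d9
        push_cast
        nlinarith)
    rw [pow_succ, mul_assoc]
    refine h2.trans ?_
    have h3 : 1 + 2 * ε ≤ Real.exp (2 * ε) := by linarith [Real.add_one_le_exp (2 * ε)]
    have h4 : Real.exp (8 * ε) = Real.exp (8 * (3 * ε / 4)) * Real.exp (2 * ε) := by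
      rw [← Real.exp_add]
      congr 1
      ring
    rw [h4]
    calc _ ≤ 2 ^ i * Real.exp (8 * (3 * ε / 4)) *
          ((2 : ℕ) * (1 + 2 * ε) * choiceNumber (multipartiteK m k)) := by gcongr
      _ ≤ 2 ^ i * Real.exp (8 * (3 * ε / 4)) *
          ((2 : ℕ) * Real.exp (2 * ε) * choiceNumber (multipartiteK m k)) := by gcongr
      _ = _ := by push_cast; ring

/-- If `l` is large compared with `k`, then it is slightly smaller than some `2 ^ i * (q * k)`
with `N ≤ q ≤ 2 * N`. -/
theorem choiceNumber_multipartiteK_div_le {m k N l : ℕ} {ε : ℝ} (hm : 1 ≤ m) (hk : 1 ≤ k)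
    (hN : 1 ≤ N) (hε : 0 < ε) (hε1 : ε ≤ 1) (hεk : 36 ≤ ε ^ 2 * k)
    (hlog : Real.log (4 * N * k * m) < ε ^ 2 * k / 6) (hl : N * k ≤ l) :
    (choiceNumber (multipartiteK m l) : ℝ) / l ≤
      (1 + 1 / N) * Real.exp (10 * ε) * (choiceNumber (multipartiteK m k) / k) := by
  have hNk : 0 < N * k := Nat.mul_pos hN hk
  have hx : l / (N * k) ≠ 0 := (Nat.div_pos hl hNk).ne'
  obtain ⟨i, hi1, hi2⟩ : ∃ i, 2 ^ i * (N * k) ≤ l ∧ l < 2 ^ (i + 1) * (N * k) := by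
    refine ⟨Nat.log 2 (l / (N * k)), ?_, ?_⟩
    · exact (Nat.le_div_iff_mul_le hNk).1 (Nat.pow_log_le_self 2 hx)
    · exact (Nat.div_lt_iff_lt_mul hNk).1 (Nat.lt_pow_succ_log_self (by norm_num) _)
  have hd : 0 < 2 ^ i * k := by positivity
  obtain ⟨q, hq1, hqN, hlq, hql⟩ : ∃ q, 1 ≤ q ∧ q ≤ 2 * N ∧ l ≤ q * (2 ^ i * k) ∧
      q * (2 ^ i * k) ≤ l + 2 ^ i * k := by
    refine ⟨l / (2 ^ i * k) + 1, Nat.le_add_left 1 _, ?_, ?_, ?_⟩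
    · rw [Nat.succ_le_iff, Nat.div_lt_iff_lt_mul hd]
      calc l < _ := hi2
        _ = _ := by ring
    · exact ((Nat.div_lt_iff_lt_mul hd).1 (Nat.lt_succ_self _)).le
    · rw [add_mul, one_mul]
      exact Nat.add_le_add_right (Nat.div_mul_le_self _ _) _
  have hm0 : (0 : ℝ) < m := by exact_mod_cast hm
  have hk0 : (0 : ℝ) < k := by exact_mod_cast hk
  have hN0 : (0 : ℝ) < N := by exact_mod_cast hN
  have hq0 : (1 : ℝ) ≤ q := by exact_mod_cast hq1
  have hl0 : (0 : ℝ) < l := by exact_mod_cast hNk.trans_le hl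
  have hqN' : (q : ℝ) ≤ 2 * N := by exact_mod_cast hqN
  have hlog2 : Real.log (2 * (q * k) * m) < ε ^ 2 * k / 6 := by
    refine lt_of_le_of_lt (Real.log_le_log (by positivity) ?_) hlog
    calc (2 : ℝ) * (q * k) * m ≤ 2 * ((2 * N) * k) * m := by gcongr
      _ = _ := by ring
  have hkq : ε ^ 2 * k ≤ ε ^ 2 * (q * k) := by
    gcongr
    nlinarith
  have h1 := choiceNumber_multipartiteK_mul_le hm hk hq1 hε hε1 (by linarith)
    (lt_of_le_of_lt (Real.log_le_log (by positivity) (by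
      have : 0 < (q : ℝ) * k * m := by positivity
      linarith)) hlog2)
  have h2 := choiceNumber_multipartiteK_two_pow_mul_le hm i (k := q * k) (Nat.mul_pos hq1 hk) hε hε1
    (by push_cast; linarith) (by push_cast; linarith)
  have h3 : (choiceNumber (multipartiteK m l) : ℝ) ≤
      choiceNumber (multipartiteK m (2 ^ i * (q * k))) := by
    refine Nat.cast_le.2 (choiceNumber_le_iff.2 ?_)
    refine (isChoosable_choiceNumber _).multipartiteK_mono (by omega) ?_
    calc l ≤ q * (2 ^ i * k) := hlq
      _ = _ := by ring
  have h4 : (2 : ℝ) ^ i * q * k ≤ (1 + 1 / N) * l := by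
    have h5 : (q : ℝ) * (2 ^ i * k) ≤ l + 2 ^ i * k := by exact_mod_cast hql
    have h6 : (2 : ℝ) ^ i * (N * k) ≤ l := by exact_mod_cast hi1
    have h7 : (2 : ℝ) ^ i * k ≤ l / N := by
      rw [le_div_iff₀ hN0]
      linarith
    have : (1 + 1 / (N : ℝ)) * l = l + l / N := by ring
    linarith
  have h5 : 1 + 2 * ε ≤ Real.exp (2 * ε) := by linarith [Real.add_one_le_exp (2 * ε)]
  have h6 : Real.exp (10 * ε) = Real.exp (8 * ε) * Real.exp (2 * ε) := by
    rw [← Real.exp_add]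
    congr 1
    ring
  set s := choiceNumber (multipartiteK m k)
  rw [div_le_iff₀ hl0]
  calc (choiceNumber (multipartiteK m l) : ℝ)
      ≤ 2 ^ i * Real.exp (8 * ε) * (q * (1 + 2 * ε) * s) := by
        refine (h3.trans h2).trans ?_
        gcongr
    _ ≤ 2 ^ i * Real.exp (8 * ε) * (q * Real.exp (2 * ε) * s) := by gcongr
    _ = (2 ^ i * q * k) * (Real.exp (10 * ε) * (s / k)) := by
        rw [h6]
        field_simp
    _ ≤ ((1 + 1 / N) * l) * (Real.exp (10 * ε) * (s / k)) := by gcongr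
    _ = _ := by ring

/-! ### Existence of the limit -/

/-- A nonnegative sequence that is almost nonincreasing, in the sense that late terms exceed
earlier ones by factors arbitrarily close to `1`, converges. -/
theorem exists_tendsto_of_eventually_le_mul {g a : ℕ → ℝ} (hg : ∀ k, 0 ≤ g k)
    (ha : Tendsto a atTop (𝓝 1))
    (h : ∀ᶠ N in atTop, ∀ᶠ k in atTop, ∀ᶠ l in atTop, g l ≤ a N * g k) :
    ∃ c, Tendsto g atTop (𝓝 c) := by
  have hbdd : IsBoundedUnder (· ≤ ·) atTop g := by
    obtain ⟨N, hN⟩ := h.exists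
    obtain ⟨k, hk⟩ := hN.exists
    exact isBoundedUnder_of_eventually_le hk
  have hbdd' : IsBoundedUnder (· ≥ ·) atTop g := isBoundedUnder_of ⟨0, hg⟩
  refine ⟨liminf g atTop, tendsto_order.2 ⟨fun b hb => eventually_lt_of_lt_liminf hb hbdd',
    fun b hb => ?_⟩⟩
  have h1 : Tendsto (fun N : ℕ => a N * (liminf g atTop + 1 / ((N : ℝ) + 1))) atTop
      (𝓝 (1 * (liminf g atTop + 0))) :=
    ha.mul (tendsto_const_nhds.add tendsto_one_div_add_atTop_nhds_zero_nat)
  have h2 : ∀ᶠ N : ℕ in atTop, a N * (liminf g atTop + 1 / ((N : ℝ) + 1)) < b :=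
    h1.eventually_lt_const (by simpa using hb)
  obtain ⟨N, hN, hNb, ha0⟩ := (h.and (h2.and (ha.eventually_const_lt one_pos))).exists
  have h3 : ∃ᶠ k in atTop, g k < liminf g atTop + 1 / ((N : ℝ) + 1) :=
    frequently_lt_of_liminf_lt hbdd.isCoboundedUnder_ge
      (lt_add_of_pos_right _ (by positivity))
  obtain ⟨k, hk, hkN⟩ := (h3.and_eventually hN).exists
  filter_upwards [hkN] with l hl
  have : a N * g k < a N * (liminf g atTop + 1 / ((N : ℝ) + 1)) := by gcongr
  linarith

theorem eventually_log_mul_lt {c δ : ℝ} (hc : 0 < c) (hδ : 0 < δ) :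
    ∀ᶠ k : ℕ in atTop, Real.log (c * k) < δ * k := by
  have h1 : Tendsto (fun k : ℕ => c * (k : ℝ)) atTop atTop :=
    tendsto_natCast_atTop_atTop.const_mul_atTop hc
  have h2 := h1.eventually (Real.isLittleO_log_id_atTop.bound (c := δ / (2 * c)) (by positivity))
  filter_upwards [h2, eventually_ge_atTop 1] with k hk hk1
  have hk0 : (0 : ℝ) < k := by exact_mod_cast hk1
  have h3 : δ / (2 * c) * ‖id (c * (k : ℝ))‖ = δ * k / 2 := by
    rw [id, Real.norm_of_nonneg (by positivity)]
    field_simp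
  rw [h3] at hk
  have := (Real.le_norm_self _).trans hk
  have : 0 < δ * k := by positivity
  linarith

theorem exists_tendsto_choiceNumber_div {m : ℕ} (hm : 1 ≤ m) :
    ∃ c : ℝ, Tendsto (fun k : ℕ => (choiceNumber (multipartiteK m k) : ℝ) / (k : ℝ)) atTop
      (𝓝 c) := by
  refine exists_tendsto_of_eventually_le_mul
    (a := fun N => (1 + 1 / (N : ℝ)) * Real.exp (10 * (1 / (N : ℝ)))) (fun k => by positivity) ?_ ?_
  · have h1 : Tendsto (fun N : ℕ => 1 / (N : ℝ)) atTop (𝓝 0) := tendsto_one_div_atTop_nhds_zero_nat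
    have h2 : Continuous fun x : ℝ => (1 + x) * Real.exp (10 * x) := by fun_prop
    simpa [Function.comp_def] using (h2.tendsto 0).comp h1
  · filter_upwards [eventually_ge_atTop 1] with N hN
    have hN1 : (1 : ℝ) ≤ N := by exact_mod_cast hN
    have hm0 : (0 : ℝ) < m := by exact_mod_cast hm
    have h1 := eventually_log_mul_lt (c := 4 * N * m) (δ := (1 / (N : ℝ)) ^ 2 / 6) (by positivity)
      (by positivity)
    have h2 : ∀ᶠ k : ℕ in atTop, 36 ≤ (1 / (N : ℝ)) ^ 2 * k :=
      (tendsto_natCast_atTop_atTop.const_mul_atTop (by positivity)).eventually_ge_atTop 36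
    filter_upwards [h1, h2, eventually_ge_atTop 1] with k hk1 hk2 hk
    filter_upwards [eventually_ge_atTop (N * k)] with l hl
    refine choiceNumber_multipartiteK_div_le hm hk hN (by positivity)
      (div_le_one_of_le₀ hN1 (by positivity)) hk2 ?_ hl
    calc Real.log (4 * N * k * m) = Real.log (4 * N * m * k) := by ring_nf
      _ < _ := hk1
      _ = _ := by ring

/-! ### The order of magnitude of the limit -/

/-- Splitting `K_{m*k}` into single classes, each of which needs only one color per list. -/
theorem choiceNumber_multipartiteK_div_le_log {m k : ℕ} (hm : 1 ≤ m) (hk : 1 ≤ k) :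
    (choiceNumber (multipartiteK m k) : ℝ) / k ≤ 2 * Real.log (k * m) + 3 := by
  have hm1 : (1 : ℝ) ≤ m := by exact_mod_cast hm
  have hk1 : (1 : ℝ) ≤ k := by exact_mod_cast hk
  have hlog : 0 ≤ Real.log (k * m) := Real.log_nonneg (by nlinarith)
  have hS := Nat.lt_floor_add_one (2 * k * (Real.log (k * m) + 1))
  have hS' := Nat.floor_le (a := 2 * k * (Real.log (k * m) + 1)) (by positivity)
  set S := ⌊2 * k * (Real.log (k * m) + 1)⌋₊
  have h1 : IsChoosable (multipartiteK m (k * 1)) (S + 1) := by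
    refine (isChoosable_multipartiteK_one m).multipartiteK_mul hm le_rfl hk (r := 1) zero_le_one ?_
    push_cast
    rw [mul_one, div_mul_div_comm, lt_div_iff₀ (by positivity)]
    linarith
  rw [mul_one] at h1
  have h2 : (choiceNumber (multipartiteK m k) : ℝ) ≤ S + 1 := by
    exact_mod_cast choiceNumber_le_iff.2 h1
  rw [div_le_iff₀ (by positivity)]
  nlinarith

theorem eventually_choiceNumber_div_le {m : ℕ} (hm : 2 ≤ m) :
    ∀ᶠ k : ℕ in atTop, (choiceNumber (multipartiteK m k) : ℝ) / (k : ℝ) ≤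
      42 * Real.exp 10 * Real.log m := by
  have hm2 : (2 : ℝ) ≤ m := by exact_mod_cast hm
  have hl2 := Real.log_two_gt_d9
  have hl2' := Real.log_two_lt_d9
  have hlm : Real.log 2 ≤ Real.log m := Real.log_le_log (by norm_num) hm2
  have hlm' : Real.log m ≤ m - 1 := Real.log_le_sub_one_of_pos (by positivity)
  have hpow : ∀ n : ℕ, Real.log (2 ^ n * m ^ 2) = n * Real.log 2 + 2 * Real.log m := by
    intro n
    rw [Real.log_mul (by positivity) (by positivity), Real.log_pow, Real.log_pow]
    norm_num
  have h1 : (choiceNumber (multipartiteK m (36 * m)) : ℝ) / (36 * m : ℕ) ≤ 21 * Real.log m := by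
    refine (choiceNumber_multipartiteK_div_le_log (by omega) (by omega)).trans ?_
    have : Real.log ((36 * m : ℕ) * m) ≤ Real.log (2 ^ 6 * m ^ 2) :=
      Real.log_le_log (by positivity) (by push_cast; nlinarith)
    rw [hpow] at this
    push_cast at this ⊢
    linarith
  filter_upwards [eventually_ge_atTop (1 * (36 * m))] with k hk
  refine (choiceNumber_multipartiteK_div_le (ε := 1) (by omega) (by omega) le_rfl one_pos le_rfl
    ?_ ?_ hk).trans ?_
  · push_cast
    linarith
  · have : Real.log (4 * (1 : ℕ) * (36 * m : ℕ) * m) ≤ Real.log (2 ^ 8 * m ^ 2) :=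
      Real.log_le_log (by positivity) (by push_cast; nlinarith)
    rw [hpow] at this
    refine this.trans_lt ?_
    push_cast
    linarith
  · calc (1 + 1 / ((1 : ℕ) : ℝ)) * Real.exp (10 * 1) *
          ((choiceNumber (multipartiteK m (36 * m)) : ℝ) / (36 * m : ℕ))
        ≤ (1 + 1 / ((1 : ℕ) : ℝ)) * Real.exp (10 * 1) * (21 * Real.log m) := by gcongr
      _ = _ := by
        norm_num
        ring

theorem eventually_le_choiceNumber_div {m : ℕ} (hm : 1 ≤ m) :
    ∀ᶠ k : ℕ in atTop, 1 / 8 * Real.log m ≤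
      (choiceNumber (multipartiteK m k) : ℝ) / (k : ℝ) := by
  filter_upwards [eventually_ge_atTop 2] with k hk
  set t := Nat.log 4 m
  have h1 : (t + 1) * (k / 2) ≤ choiceNumber (multipartiteK m k) := by
    refine le_of_not_ge fun hle => not_isChoosable_multipartiteK (m := m) (k := k) (t := t)
      (B := k / 2) (Nat.pow_log_le_self 4 (by omega)) ?_ (choiceNumber_le_iff.1 hle)
    have : 2 * (k / 2) * (t + 1) ≤ k * (t + 1) := Nat.mul_le_mul_right _ (Nat.mul_div_le k 2)
    have : 1 ≤ k / 2 := by omega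
    nlinarith
  have h2 : ((t : ℝ) + 1) * (k / 2 : ℕ) ≤ choiceNumber (multipartiteK m k) := by exact_mod_cast h1
  have h3 : (k : ℝ) ≤ 4 * (k / 2 : ℕ) := by
    have : k ≤ 4 * (k / 2) := by omega
    exact_mod_cast this
  have h4 : Real.log m ≤ 2 * ((t : ℝ) + 1) := by
    have h5 : (m : ℝ) ≤ 4 ^ (t + 1) := by
      exact_mod_cast (Nat.lt_pow_succ_log_self (by norm_num) m).le
    have h6 := Real.log_le_log (by exact_mod_cast hm) h5
    have h7 : Real.log 4 ≤ 2 := by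
      rw [show (4 : ℝ) = 2 ^ 2 by norm_num, Real.log_pow]
      have := Real.log_two_lt_d9
      push_cast
      linarith
    rw [Real.log_pow] at h6
    push_cast at h6
    nlinarith
  have hk0 : (0 : ℝ) < k := by exact_mod_cast (by omega : 0 < k)
  rw [le_div_iff₀ hk0]
  calc 1 / 8 * Real.log m * k ≤ 1 / 8 * (2 * ((t : ℝ) + 1)) * (4 * (k / 2 : ℕ)) := by gcongr
    _ = ((t : ℝ) + 1) * (k / 2 : ℕ) := by ring
    _ ≤ _ := h2

theorem theorem3p2 :
    ∃ c : ℕ → ℝ,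
      (∀ m : ℕ, 1 ≤ m →
        Tendsto (fun k : ℕ => (choiceNumber (multipartiteK m k) : ℝ) / (k : ℝ)) atTop (𝓝 (c m))) ∧
      ∃ a b : ℝ, 0 < a ∧ 0 < b ∧
        ∀ m : ℕ, 2 ≤ m → a * Real.log (m : ℝ) ≤ c m ∧ c m ≤ b * Real.log (m : ℝ) := by
  choose! c hc using fun (m : ℕ) (hm : 1 ≤ m) => exists_tendsto_choiceNumber_div hm
  refine ⟨c, hc, 1 / 8, 42 * Real.exp 10, by norm_num, by positivity, fun m hm => ?_⟩
  exact ⟨ge_of_tendsto (hc m (by omega)) (eventually_le_choiceNumber_div (by omega)),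
    le_of_tendsto (hc m (by omega)) (eventually_choiceNumber_div_le hm)⟩
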